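/- Consider a linear time-invariant system $\dot x=Ax+Bu$, $y=Cx$ with real matrices $A\in\mathbb R^{n\times n}$, $B\in\mathbb R^{n\times r}$, $C\in\mathbb R^{r\times n}$ (equal number of inputs and outputs), completely state controllable, with $\operatorname{rank}B=r$. Let $P(s)=\begin{bmatrix} sI_n-A&-B\\ C&O\end{bmatrix}$ be its system matrix. The system zeros are the complex zeros, counted with multiplicity, of the greatest common divisor of those minors of $P(s)$ of the maximal order $n+\delta$ that contain the first $n$ rows and the first $n$ columns of $P(s)$; here $\delta$ is the largest integer for which such a minor is not identically zero. Let $\nu$ be the controllability index of $(A,B)$, i.e. the smallest integer with $\operatorname{rank}[B,AB,\dots,A^{n-1}B]=\operatorname{rank}[B,AB,\dots,A^{\nu-1}B]$, and put $l_0=0$ and $l_i=\operatorname{rank}[B,\dots,A^{\nu-i}B]-\operatorname{rank}[B,\dots,A^{\nu-i-1}B]$ for $1\le i\le\nu$ (the rank of an empty matrix being $0$), so that $l_1\le\dots\le l_\nu=r$ and $l_1+\dots+l_\nu=n$. A pair consisting of a nonsingular $n\times n$ matrix $N$ and an $r\times r$ permutation matrix $M$ reduces $(A,B)$ to Yokoyama's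 canonical form if $$NAN^{-1}=\begin{bmatrix} O&E_{1,2}&O&\cdots&O\\ O&O&E_{2,3}&\cdots&O\\ \vdots&\vdots&\vdots&\ddots&\vdots\\ O&O&O&\cdots&E_{\nu-1,\nu}\\ F_{\nu1}&F_{\nu2}&F_{\nu3}&\cdots&F_{\nu\nu}\end{bmatrix},\qquad NBM=\begin{bmatrix}O\\ G_\nu\end{bmatrix},$$ where $E_{i,i+1}=[O,I_{l_i}]$ is $l_i\times l_{i+1}$, the blocks $F_{\nu i}$ are arbitrary $r\times l_i$ matrices, and the $r\times r$ matrix $G_\nu$ is lower block triangular with diagonal blocks equal to identity matrices of orders $l_\nu-l_{\nu-1},\ l_{\nu-1}-l_{\nu-2},\dots,\ l_1-l_0$. Partition $CN^{-1}=[C_1,\dots,C_\nu]$ with $C_i$ of size $r\times l_i$, let $\beta=l_1+\dots+l_{\nu-2}$, and let $$Z(s)=s\begin{bmatrix} I_\beta&O\\ O&C_\nu\end{bmatrix}+\begin{bmatrix}-\bar E\\ C_1,\ C_2,\dots,C_{\nu-2},\ [O,C_{\nu-1}]\end{bmatrix},$$ where $[O,C_{\nu-1}]$ is $r\times r$ and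 $\bar E$ is the $\beta\times(\beta+r)$ matrix, partitioned into block rows of sizes $l_1,\dots,l_{\nu-2}$ and block columns of sizes $l_1,\dots,l_{\nu-2},r$, whose only nonzero blocks are $E_{i,i+1}$ in position $(i,i+1)$ for $1\le i\le\nu-3$ and the $l_{\nu-2}\times r$ block $[O,E_{\nu-2,\nu-1}]=[O,I_{l_{\nu-2}}]$ in the last block column of the last block row. (For $\nu\le2$ we have $\beta=0$ and $\bar E$ is empty; for $\nu=1$ the block $C_{\nu-1}$ is empty and $[O,C_{\nu-1}]=O$.) Theorem. Matrices $N,M$ reducing $(A,B)$ to Yokoyama's canonical form exist. One has $l_{\nu-1}\le r$, and the pencil $Z(s)$ has size $(n-l_{\nu-1})\times(n-l_{\nu-1})$. For every choice of such $N,M$: 1. $Z(s)$ is regular ($\det Z(s)\not\equiv0$) if and only if $\det P(s)\not\equiv0$. 2. If $\det P(s)\not\equiv0$, then the system zeros are the generalized eigenvalues of $Z(s)$ (the complex zeros of $\det Z(s)$) with $r-l_{\nu-1}$ generalized eigenvalues at the origin removed, everything counted with multiplicity. 3. In particular, if $\det P(s)\not\equiv0$ and $l_{\nu-1}=r$, then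 $Z(s)$ has size $(n-r)\times(n-r)$ and its generalized eigenvalues, counted with multiplicity, are exactly the system zeros. The matrix $CB$ is allowed to be singular. -/

import Mathlib

namespace SystemZeros

noncomputable section

/-! A linear time-invariant system `x' = A x + B u`, `y = C x` with real constant matrices. -/

/-- Complete state controllability: for all times `t₀ < t₁` and all states `x₀`, `x₁` some
(continuous) control on `[t₀, t₁]` drives the state from `x₀` at time `t₀` to `x₁` at `t₁`. -/
def Controllable {n r : ℕ} (A : Matrix (Fin n) (Fin n) ℝ) (B : Matrix (Fin n) (Fin r) ℝ) : Prop :=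
  ∀ t₀ t₁ : ℝ, t₀ < t₁ → ∀ x₀ x₁ : Fin n → ℝ,
    ∃ (u : ℝ → Fin r → ℝ) (x : ℝ → Fin n → ℝ),
      ContinuousOn u (Set.Icc t₀ t₁) ∧
      (∀ t ∈ Set.Icc t₀ t₁,
        HasDerivWithinAt x (A.mulVec (x t) + B.mulVec (u t)) (Set.Icc t₀ t₁) t) ∧
      x t₀ = x₀ ∧ x t₁ = x₁

/-! ### System matrix and system zeros -/

/-- Rosenbrock's system matrix `P(s) = [sI - A, -B; C, 0]`. -/
def systemMatrix {n r l : ℕ} (A : Matrix (Fin n) (Fin n) ℝ) (B : Matrix (Fin n) (Fin r) ℝ)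
    (C : Matrix (Fin l) (Fin n) ℝ) :
    Matrix (Fin n ⊕ Fin l) (Fin n ⊕ Fin r) (Polynomial ℝ) :=
  Matrix.fromBlocks A.charmatrix (-(B.map Polynomial.C)) (C.map Polynomial.C) 0

/-- The minor of `P(s)` of order `n + k` formed by the first `n` rows and columns together with
the rows `n + i₁, …, n + i_k` and the columns `n + j₁, …, n + j_k`. -/
def systemMinor {n r l : ℕ} (A : Matrix (Fin n) (Fin n) ℝ) (B : Matrix (Fin n) (Fin r) ℝ)
    (C : Matrix (Fin l) (Fin n) ℝ) {k : ℕ} (f : Fin k ↪o Fin l) (g : Fin k ↪o Fin r) :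
    Polynomial ℝ :=
  ((systemMatrix A B C).submatrix (Sum.map id f) (Sum.map id g)).det

/-- The largest `k` for which some minor of order `n + k` of the above form is not identically
zero (`k` is bounded by `min l r`, and `k = 0` gives `det (sI - A) ≠ 0`). -/
def maxMinorSize {n r l : ℕ} (A : Matrix (Fin n) (Fin n) ℝ) (B : Matrix (Fin n) (Fin r) ℝ)
    (C : Matrix (Fin l) (Fin n) ℝ) : ℕ :=
  sSup {k : ℕ | ∃ (f : Fin k ↪o Fin l) (g : Fin k ↪o Fin r), systemMinor A B C f g ≠ 0}

/-- The zero polynomial of the system: the greatest common divisor (generator of the ideal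
generated by) the minors of the above form of the maximal order. -/
def zeroPolynomial {n r l : ℕ} (A : Matrix (Fin n) (Fin n) ℝ) (B : Matrix (Fin n) (Fin r) ℝ)
    (C : Matrix (Fin l) (Fin n) ℝ) : Polynomial ℝ :=
  Submodule.IsPrincipal.generator
    (Ideal.span {p : Polynomial ℝ | ∃ (f : Fin (maxMinorSize A B C) ↪o Fin l)
      (g : Fin (maxMinorSize A B C) ↪o Fin r), p = systemMinor A B C f g})

/-- The complete set of system zeros: the complex zeros, with multiplicities, of the zero
polynomial. -/
def systemZeros {n r l : ℕ} (A : Matrix (Fin n) (Fin n) ℝ) (B : Matrix (Fin n) (Fin r) ℝ)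
    (C : Matrix (Fin l) (Fin n) ℝ) : Multiset ℂ :=
  (zeroPolynomial A B C).aroots ℂ

/-! ### Matrix pencils -/

/-- The matrix pencil `s D + L`. -/
def pencil {ι : Type} (D L : Matrix ι ι ℝ) : Matrix ι ι (Polynomial ℝ) :=
  (Polynomial.X : Polynomial ℝ) • D.map Polynomial.C + L.map Polynomial.C

/-- A square pencil is regular if its determinant is not identically zero. -/
def IsRegularPencil {ι : Type} [Fintype ι] [DecidableEq ι] (Z : Matrix ι ι (Polynomial ℝ)) :
    Prop :=
  Z.det ≠ 0

/-- The (finite) generalized eigenvalues of a regular pencil, with multiplicities. -/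
def genEigenvalues {ι : Type} [Fintype ι] [DecidableEq ι] (Z : Matrix ι ι (Polynomial ℝ)) :
    Multiset ℂ :=
  Z.det.aroots ℂ

/-! ### Controllability index and Yokoyama's canonical form -/

/-- The rank of `[B, AB, …, A^(k-1) B]`. -/
def ctrlRank {n r : ℕ} (A : Matrix (Fin n) (Fin n) ℝ) (B : Matrix (Fin n) (Fin r) ℝ) (k : ℕ) : ℕ :=
  (Matrix.of fun (i : Fin n) (p : Fin k × Fin r) => (A ^ (p.1 : ℕ) * B) i p.2).rank

/-- The controllability index `ν`: the smallest integer with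
`rank [B, AB, …, A^(n-1) B] = rank [B, AB, …, A^(ν-1) B]`. -/
def ctrlIndex {n r : ℕ} (A : Matrix (Fin n) (Fin n) ℝ) (B : Matrix (Fin n) (Fin r) ℝ) : ℕ :=
  sInf {k : ℕ | ctrlRank A B n = ctrlRank A B k}

/-- The integers `l₁, …, l_ν`, namely
`l_i = rank [B, …, A^(ν-i) B] - rank [B, …, A^(ν-i-1) B]`, with the convention `l₀ = 0`. -/
def blockSize {n r : ℕ} (A : Matrix (Fin n) (Fin n) ℝ) (B : Matrix (Fin n) (Fin r) ℝ) : ℕ → ℕ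
  | 0 => 0
  | i + 1 => ctrlRank A B (ctrlIndex A B - i) - ctrlRank A B (ctrlIndex A B - (i + 1))

/-- Indices of the transformed state, which is partitioned into blocks of sizes `l₁, …, l_ν`
(the block with number `0` is empty). -/
abbrev StateIdx {n r : ℕ} (A : Matrix (Fin n) (Fin n) ℝ) (B : Matrix (Fin n) (Fin r) ℝ) : Type :=
  Σ i : Fin (ctrlIndex A B + 1), Fin (blockSize A B i)

/-- The `p × q` matrix `[O, I_p]` (for `p ≤ q`). -/
def rightId (p q : ℕ) : Matrix (Fin p) (Fin q) ℝ :=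
  Matrix.of fun a b => if (b : ℕ) + p = (a : ℕ) + q then 1 else 0

/-- Yokoyama's canonical form of the pair `(A, B)`, reached by the change of state `z = N x`
(`T` is the inverse of `N`) and of input `v = M⁻¹ u`, `M` the permutation matrix of `σ`:
`F = N A N⁻¹` and `G = N B M`. -/
structure IsYokoyama {n r : ℕ} (A : Matrix (Fin n) (Fin n) ℝ) (B : Matrix (Fin n) (Fin r) ℝ)
    (N : Matrix (StateIdx A B) (Fin n) ℝ) (T : Matrix (Fin n) (StateIdx A B) ℝ)
    (σ : Equiv.Perm (Fin r)) : Prop where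
  mul_inv : N * T = 1
  inv_mul : T * N = 1
  /-- In the block rows `i = 1, …, ν - 1` the matrix `F` has the only nonzero block
  `E_{i,i+1} = [O, I_{l_i}]`; the last block row of `F` is arbitrary. -/
  companion : ∀ p q : StateIdx A B, (p.1 : ℕ) < ctrlIndex A B →
    (N * A * T) p q =
      if (q.1 : ℕ) = (p.1 : ℕ) + 1 then
        rightId (blockSize A B p.1) (blockSize A B q.1) p.2 q.2
      else 0
  /-- All block rows of `G` but the last one, `G_ν`, vanish. -/
  input_top : ∀ (p : StateIdx A B) (b : Fin r), (p.1 : ℕ) < ctrlIndex A B →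
    (N * B * σ.permMatrix ℝ) p b = 0
  /-- `G_ν` is lower triangular. -/
  input_upper : ∀ (p : StateIdx A B) (b : Fin r), (p.1 : ℕ) = ctrlIndex A B →
    (p.2 : ℕ) < (b : ℕ) → (N * B * σ.permMatrix ℝ) p b = 0
  /-- `G_ν` has unit diagonal. -/
  input_diag : ∀ (p : StateIdx A B) (b : Fin r), (p.1 : ℕ) = ctrlIndex A B →
    (p.2 : ℕ) = (b : ℕ) → (N * B * σ.permMatrix ℝ) p b = 1
  /-- The diagonal blocks of `G_ν`, of orders `l_ν - l_{ν-1}, …, l₂ - l₁, l₁`, are identity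
  matrices: an off-diagonal entry vanishes unless a boundary `r - l_j` between two
  diagonal blocks separates its row from its column. -/
  input_blocks : ∀ (p : StateIdx A B) (b : Fin r), (p.1 : ℕ) = ctrlIndex A B →
    (p.2 : ℕ) ≠ (b : ℕ) →
    (∀ j ≤ ctrlIndex A B,
      ((p.2 : ℕ) + blockSize A B j < r ↔ (b : ℕ) + blockSize A B j < r)) →
    (N * B * σ.permMatrix ℝ) p b = 0

/-! ### The pencil of order `n - l_{ν-1}` -/

/-- The block `C_i` of `C N⁻¹ = [C₁, …, C_ν]`, of size `r × l_i`. -/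
def outBlock {n r : ℕ} (A : Matrix (Fin n) (Fin n) ℝ) (B : Matrix (Fin n) (Fin r) ℝ)
    (C : Matrix (Fin r) (Fin n) ℝ) (T : Matrix (Fin n) (StateIdx A B) ℝ)
    (i : Fin (ctrlIndex A B + 1)) : Matrix (Fin r) (Fin (blockSize A B i)) ℝ :=
  Matrix.of fun a b => (C * T) a ⟨i, b⟩

/-- The `r × r` matrix `[O, C_i] = C_i [O, I_{l_i}]`; for `i = ν` it is `C_ν`, as `l_ν = r`. -/
def outBlockPad {n r : ℕ} (A : Matrix (Fin n) (Fin n) ℝ) (B : Matrix (Fin n) (Fin r) ℝ)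
    (C : Matrix (Fin r) (Fin n) ℝ) (T : Matrix (Fin n) (StateIdx A B) ℝ)
    (i : Fin (ctrlIndex A B + 1)) : Matrix (Fin r) (Fin r) ℝ :=
  outBlock A B C T i * rightId (blockSize A B i) r

/-- Indices of the first `β = l₁ + ⋯ + l_{ν-2}` rows and columns of the pencil: pairs of a block
number `i ≤ ν - 2` (block `0` is empty) and a position in that block. -/
abbrev HeadIdx {n r : ℕ} (A : Matrix (Fin n) (Fin n) ℝ) (B : Matrix (Fin n) (Fin r) ℝ) : Type :=
  Σ i : Fin (ctrlIndex A B - 1), Fin (blockSize A B i)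

/-- The first `β` columns of `Ē`, with the blocks `E_{i,i+1} = [O, I_{l_i}]`, `i + 1 ≤ ν - 2`. -/
def barEHead {n r : ℕ} (A : Matrix (Fin n) (Fin n) ℝ) (B : Matrix (Fin n) (Fin r) ℝ) :
    Matrix (HeadIdx A B) (HeadIdx A B) ℝ :=
  Matrix.of fun p q =>
    if (q.1 : ℕ) = (p.1 : ℕ) + 1 then
      rightId (blockSize A B p.1) (blockSize A B q.1) p.2 q.2
    else 0

/-- The last `r` columns of `Ē`; the only nonzero block is the `l_{ν-2} × r` block
`[O, E_{ν-2,ν-1}] = [O, I_{l_{ν-2}}]` in the block row `ν - 2`. -/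
def barETail {n r : ℕ} (A : Matrix (Fin n) (Fin n) ℝ) (B : Matrix (Fin n) (Fin r) ℝ) :
    Matrix (HeadIdx A B) (Fin r) ℝ :=
  Matrix.of fun p b =>
    if (p.1 : ℕ) + 2 = ctrlIndex A B then rightId (blockSize A B p.1) r p.2 b else 0

/-- `[C₁, …, C_{ν-2}]`. -/
def outHead {n r : ℕ} (A : Matrix (Fin n) (Fin n) ℝ) (B : Matrix (Fin n) (Fin r) ℝ)
    (C : Matrix (Fin r) (Fin n) ℝ) (T : Matrix (Fin n) (StateIdx A B) ℝ) :
    Matrix (Fin r) (HeadIdx A B) ℝ :=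
  Matrix.of fun a q => outBlock A B C T ⟨q.1, by have := q.1.isLt; omega⟩ a q.2

/-- The pencil `Z(s) = s diag(I_β, C_ν) + [-Ē; C₁, …, C_{ν-2}, [O, C_{ν-1}]]`. -/
def zeroPencil {n r : ℕ} (A : Matrix (Fin n) (Fin n) ℝ) (B : Matrix (Fin n) (Fin r) ℝ)
    (C : Matrix (Fin r) (Fin n) ℝ) (T : Matrix (Fin n) (StateIdx A B) ℝ) :
    Matrix (HeadIdx A B ⊕ Fin r) (HeadIdx A B ⊕ Fin r) (Polynomial ℝ) :=
  pencil
    (Matrix.fromBlocks 1 0 0 (outBlockPad A B C T (Fin.last (ctrlIndex A B))))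
    (Matrix.fromBlocks (-barEHead A B) (-barETail A B) (outHead A B C T)
      (outBlockPad A B C T ⟨ctrlIndex A B - 1, by omega⟩))

end

end SystemZeros

open SystemZeros

/-!
Let `ν` be the controllability index and `l_i` the block sizes. The argument has three parts.

*Existence of Yokoyama's form.* Let `W_k` be the space of row vectors `w` with `w A ^ j B = 0` for
all `j < k`, and `R_i = {w A ^ (ν - i) B | w ∈ W_{ν-i}}`. The kernel of `w ↦ w A ^ k B` on `W_k` is
`W_{k+1}`, so `dim R_i = l_i` (`finrank_ctrlFlag_sub`); here Kalman's rank condition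
`W_ν = 0` enters, which is derived from the definition of controllability by trajectories
(`ctrlAnnihilator_eq_bot`). The spaces `R_i` form a flag that ends with the whole space, and
after a permutation of the inputs this flag has an adapted basis `g` in echelon form
(`exists_echelon_basis_of_flag`): the positions of leading entries of the vectors of `R_i` increase
with `i`, and the permutation sorts them. If `g a` occurs first in `R_d`, write
`g a = w A ^ (ν - d) B` with `w ∈ W_{ν-d}`; the rows of `N` are the chains `w, w A, w A ^ 2, …`,
placed in the blocks `d, d + 1, …, ν`. They are independent (`eq_zero_of_sum_chains`), and the last
block of `N B` consists of the vectors `g` (`exists_isYokoyama`).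

*The determinant of the pencil.* In Yokoyama's coordinates the unitriangular block `G_ν` of the
input matrix eliminates the last block row of `s I - F`. What remains is a matrix `Q(s)` whose last
state rows are `[0, s I, -[O, I]]`, in the columns of the blocks before `ν - 1`, of `ν - 1` and of
`ν`. Adding multiples of the columns of block `ν - 1` to `s` times those of block `ν` turns these
rows into `[0, s I, 0]` and the other entries into those of `Z(s)`, which shows
`s ^ r det Q(s) = s ^ l_{ν-1} det Z(s)` (`det_mul_pow_eq_pow_mul_det`). Hence `det Z(s)` is
`s ^ (r - l_{ν-1}) det P(s)` up to a nonzero constant (`associated_det_zeroPencil`).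

*System zeros.* If `det P(s)` does not vanish identically, it is the only minor of maximal order, so
it is the zero polynomial up to a constant (`associated_zeroPolynomial`).
-/

namespace SystemZeros

/-! ### Determinants of block matrices -/

open Matrix in
/-- Exchanging the last two block rows makes a bordered matrix block triangular. -/
theorem det_border_swap {t ι R : Type*} [Fintype t] [DecidableEq t] [Fintype ι] [DecidableEq ι]
    [CommRing R] (S₁₁ : Matrix t t R) (S₁₂ : Matrix t ι R) (S₂₁ : Matrix ι t R)
    (S₂₂ G : Matrix ι ι R) (C₁ : Matrix ι t R) (C₂ : Matrix ι ι R) :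
    ∃ ε : ℤˣ, (fromBlocks (fromBlocks S₁₁ S₁₂ S₂₁ S₂₂) (fromRows 0 G) (fromCols C₁ C₂) 0).det =
      ((ε : ℤ) : R) * (G.det * (fromBlocks S₁₁ S₁₂ C₁ C₂).det) := by
  let e : Equiv.Perm ((t ⊕ ι) ⊕ ι) :=
    (Equiv.sumAssoc t ι ι).trans
      ((Equiv.sumCongr (Equiv.refl t) (Equiv.sumComm ι ι)).trans (Equiv.sumAssoc t ι ι).symm)
  set M := fromBlocks (fromBlocks S₁₁ S₁₂ S₂₁ S₂₂) (fromRows 0 G) (fromCols C₁ C₂) 0 with hM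
  have h1 : M.submatrix e id =
      fromBlocks (fromBlocks S₁₁ S₁₂ C₁ C₂) 0 (fromCols S₂₁ S₂₂) G := by
    ext ((i | i) | i) ((j | j) | j) <;> simp [e, hM]
  have h2 := det_permute e M
  rw [h1, det_fromBlocks_zero₁₂] at h2
  refine ⟨Equiv.Perm.sign e, ?_⟩
  rw [mul_comm G.det, h2, ← mul_assoc, ← Int.cast_mul, ← Units.val_mul, Int.units_mul_self]
  simp

open Matrix in
/-- Adding the block column of `C₂`, times `E₂`, to `s` times the last block column turns the middle
block row `[0, s, -E₂]` into `[0, s, 0]`; its row and column then split off. -/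
theorem det_mul_pow_eq_pow_mul_det {h k ι R : Type*} [Fintype h] [DecidableEq h] [Fintype k]
    [DecidableEq k] [Fintype ι] [DecidableEq ι] [CommRing R] (s : R) (H : Matrix h h R)
    (E₁ : Matrix h k R) (E₂ : Matrix k ι R) (C₁ : Matrix ι h R) (C₂ : Matrix ι k R)
    (C₃ : Matrix ι ι R) :
    (fromBlocks (fromBlocks H (-E₁) 0 (s • 1)) (fromRows 0 (-E₂)) (fromCols C₁ C₂) C₃).det *
        s ^ Fintype.card ι =
      s ^ Fintype.card k *
        (fromBlocks H (-(E₁ * E₂)) C₁ (C₂ * E₂ + s • C₃)).det := by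
  have h1 : fromBlocks (fromBlocks H (-E₁) 0 (s • 1)) (fromRows 0 (-E₂)) (fromCols C₁ C₂) C₃ *
      fromBlocks (1 : Matrix (h ⊕ k) (h ⊕ k) R) (fromRows 0 E₂) 0 (s • 1) =
      fromBlocks (fromBlocks H (-E₁) 0 (s • 1)) (fromRows (-(E₁ * E₂)) 0) (fromCols C₁ C₂)
        (C₂ * E₂ + s • C₃) := by
    rw [fromBlocks_multiply]
    congr 1
    · simp
    · rw [fromBlocks_mul_fromRows]
      ext (i | i) j <;> simp
    · simp
    · simp [fromCols_mul_fromRows]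
  have h2 := congrArg det h1
  rw [det_mul, det_fromBlocks_zero₂₁, det_one, one_mul, det_smul, det_one, mul_one] at h2
  rw [h2]
  let e : k ⊕ (h ⊕ ι) ≃ (h ⊕ k) ⊕ ι :=
    (Equiv.sumAssoc k h ι).symm.trans (Equiv.sumCongr (Equiv.sumComm k h) (Equiv.refl ι))
  rw [← det_submatrix_equiv_self e]
  have h3 : (fromBlocks (fromBlocks H (-E₁) 0 (s • 1)) (fromRows (-(E₁ * E₂)) 0)
      (fromCols C₁ C₂) (C₂ * E₂ + s • C₃)).submatrix e e =
      fromBlocks (s • 1) 0 (fromRows (-E₁) C₂)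
        (fromBlocks H (-(E₁ * E₂)) C₁ (C₂ * E₂ + s • C₃)) := by
    ext (i | i | i) (j | j | j) <;> simp [e]
  rw [h3, det_fromBlocks_zero₁₂, det_smul, det_one, mul_one]

theorem rightId_mul_rightId {p q t : ℕ} (hpq : p ≤ q) :
    rightId p q * rightId q t = rightId p t := by
  ext a b
  have hc : (a : ℕ) + (q - p) < q := by omega
  rw [Matrix.mul_apply, Finset.sum_eq_single ⟨(a : ℕ) + (q - p), hc⟩]
  · simp only [rightId, Matrix.of_apply]
    rw [if_pos (by omega), one_mul]
    exact if_congr (by omega) rfl rfl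
  · intro c _ hne
    have : ¬ ((c : ℕ) + p = a + q) := fun h => hne (Fin.ext (by simp; omega))
    simp [rightId, this]
  · simp

/-! ### Echelon bases of flags -/

/-- The positions at which some vector of `V` has its first nonzero entry (the pivot columns of
the reduced row echelon form of `V`). -/
noncomputable def leadingPositions {K : Type*} [Field K] {r : ℕ} (V : Submodule K (Fin r → K)) :
    Finset (Fin r) :=
  open Classical in {b | ∃ v ∈ V, v b ≠ 0 ∧ ∀ c < b, v c = 0}

section LeadingPositions

variable {K : Type*} [Field K] {r : ℕ}

theorem mem_leadingPositions {V : Submodule K (Fin r → K)} {b : Fin r} :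
    b ∈ leadingPositions V ↔ ∃ v ∈ V, v b ≠ 0 ∧ ∀ c < b, v c = 0 := by
  simp [leadingPositions]

theorem leadingPositions_mono {V W : Submodule K (Fin r → K)} (h : V ≤ W) :
    leadingPositions V ⊆ leadingPositions W := fun b hb => by
  rw [mem_leadingPositions] at hb ⊢
  obtain ⟨v, hv, h'⟩ := hb
  exact ⟨v, h hv, h'⟩

theorem eq_zero_of_forall_leadingPositions {V : Submodule K (Fin r → K)} {v : Fin r → K}
    (hv : v ∈ V) (h : ∀ b ∈ leadingPositions V, v b = 0) : v = 0 := by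
  have key : ∀ b : Fin r, v b = 0 := fun b => by
    induction b using WellFoundedLT.induction with
    | ind b ih =>
      by_contra hb
      exact hb (h b (mem_leadingPositions.2 ⟨v, hv, hb, ih⟩))
  exact funext key

/-- Restriction of the vectors of `V` to the leading positions of `V`. -/
noncomputable def restrictLeading (V : Submodule K (Fin r → K)) :
    V →ₗ[K] (leadingPositions V → K) :=
  (LinearMap.funLeft K K (fun b : leadingPositions V => b.1)).comp V.subtype

theorem injective_restrictLeading (V : Submodule K (Fin r → K)) :
    Function.Injective (restrictLeading V) := by
  rw [injective_iff_map_eq_zero]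
  intro v hv
  exact Subtype.ext (eq_zero_of_forall_leadingPositions v.2 fun b hb => congrFun hv ⟨b, hb⟩)

theorem card_leadingPositions (V : Submodule K (Fin r → K)) :
    (leadingPositions V).card = Module.finrank K V := by
  apply le_antisymm
  · have hex : ∀ b : leadingPositions V, ∃ v ∈ V, v b ≠ 0 ∧ ∀ c < b.1, v c = 0 :=
      fun b => mem_leadingPositions.1 b.2
    choose v hvV hvb hvc using hex
    have hli : LinearIndependent K (fun b => (⟨v b, hvV b⟩ : V)) := by
      rw [Fintype.linearIndependent_iff]
      intro g hg b
      have hg' : ∀ c : Fin r, ∑ i, g i * v i c = 0 := fun c => by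
        have := congrFun (congrArg Subtype.val hg) c
        simpa using this
      induction b using WellFoundedLT.induction with
      | ind b ih =>
        have h1 := hg' b
        rw [Finset.sum_eq_single b] at h1
        · exact (mul_eq_zero.1 h1).resolve_right (hvb b)
        · intro i _ hi
          rcases lt_or_gt_of_ne hi with h | h
          · rw [ih i h, zero_mul]
          · rw [hvc i b h, mul_zero]
        · simp
    have := hli.fintype_card_le_finrank
    simpa using this
  · simpa using LinearMap.finrank_le_finrank_of_injective (injective_restrictLeading V)

/-- The vectors of the reduced row echelon basis of `V`. -/
theorem exists_eq_single_on_leadingPositions (V : Submodule K (Fin r → K)) {b : Fin r} :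
    ∃ v ∈ V, ∀ c ∈ leadingPositions V, v c = if b = c then 1 else 0 := by
  have hs : Function.Surjective (restrictLeading V) :=
    (LinearMap.injective_iff_surjective_of_finrank_eq_finrank
      (by simp [card_leadingPositions])).1
      (injective_restrictLeading V)
  obtain ⟨v, hv⟩ := hs fun c => if b = c.1 then 1 else 0
  exact ⟨v, v.2, fun c hc => congrFun hv ⟨c, hc⟩⟩

/-- An upper set of `Fin r` consists of the last elements. -/
theorem mem_iff_le_add_card_of_isUpperSet {U : Finset (Fin r)} (hU : IsUpperSet (U : Set (Fin r)))
    (a : Fin r) : a ∈ U ↔ r ≤ a + U.card := by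
  constructor
  · intro ha
    have h1 : Finset.Ici a ⊆ U := fun b hb => hU (Finset.mem_Ici.1 hb) ha
    have := Finset.card_le_card h1
    rw [Fin.card_Ici] at this
    omega
  · intro h
    by_contra ha
    have h1 : U ⊆ Finset.Ioi a := fun b hb =>
      Finset.mem_Ioi.2 (lt_of_not_ge fun hba => ha (hU hba hb))
    have := Finset.card_le_card h1
    rw [Fin.card_Ioi] at this
    have := a.2
    omega

/-- A basis adapted to the flag `R 0 ≤ R 1 ≤ ⋯ ≤ R ν = ⊤`, in echelon form after the permutation
`σ` of the coordinates: the last `dim (R i)` vectors span `R i`, and `g a`, which first occurs in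
`R (d a)`, is a unit vector with respect to the last `dim (R (d a))` coordinates. -/
theorem exists_echelon_basis_of_flag (ν : ℕ) (R : ℕ → Submodule K (Fin r → K)) (hR : Monotone R)
    (hν : R ν = ⊤) :
    ∃ (σ : Equiv.Perm (Fin r)) (g : Fin r → Fin r → K) (d : Fin r → ℕ),
      ∀ a, d a ≤ ν ∧ g a ∈ R (d a) ∧
        (∀ i, r ≤ a + Module.finrank K (R i) ↔ d a ≤ i) ∧
        ∀ b : Fin r, r ≤ b + Module.finrank K (R (d a)) → g a (σ b) = if a = b then 1 else 0 := by
  classical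
  have hex : ∀ c : Fin r, ∃ i, c ∈ leadingPositions (R i) := fun c => ⟨ν, by
    rw [hν, mem_leadingPositions]
    exact ⟨Pi.single c 1, trivial, by simp, fun b hb => by simp [hb.ne]⟩⟩
  let f : Fin r → ℕ := fun c => Nat.find (hex c)
  have hf : ∀ c i, c ∈ leadingPositions (R i) ↔ f c ≤ i := fun c i =>
    ⟨fun h => Nat.find_min' _ h, fun h => leadingPositions_mono (hR h) (Nat.find_spec (hex c))⟩
  let σ : Equiv.Perm (Fin r) := Tuple.sort (fun c => OrderDual.toDual (f c))
  have hσ : ∀ a b, a ≤ b → f (σ b) ≤ f (σ a) := fun a b hab =>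
    Tuple.monotone_sort (fun c => OrderDual.toDual (f c)) hab
  have hpos : ∀ (a : Fin r) i, r ≤ a + Module.finrank K (R i) ↔ f (σ a) ≤ i := by
    intro a i
    have hup : IsUpperSet (((leadingPositions (R i)).map σ.symm.toEmbedding : Finset (Fin r)) :
        Set (Fin r)) := by
      intro a b hab ha
      simp only [Finset.mem_coe, Finset.mem_map_equiv, Equiv.symm_symm, hf] at ha ⊢
      exact (hσ a b hab).trans ha
    rw [← card_leadingPositions, ← Finset.card_map σ.symm.toEmbedding,
      ← mem_iff_le_add_card_of_isUpperSet hup, Finset.mem_map_equiv, Equiv.symm_symm, hf]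
  choose g hgR hg using fun a : Fin r =>
    exists_eq_single_on_leadingPositions (R (f (σ a))) (b := σ a)
  refine ⟨σ, g, fun a => f (σ a), fun a => ⟨?_, hgR a, hpos a, fun b hb => ?_⟩⟩
  · rw [← hpos, hν]
    simp
  · rw [hg a (σ b) ((hf _ _).2 ((hpos b _).1 hb))]
    simp

end LeadingPositions

/-! ### Controllability and ranks -/

section Kalman

open Matrix

variable {n r : ℕ} (A : Matrix (Fin n) (Fin n) ℝ) (B : Matrix (Fin n) (Fin r) ℝ)

/-- The row vectors `w` that annihilate `B, A B, …, A ^ (k - 1) B`. -/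
def ctrlAnnihilator (k : ℕ) : Submodule ℝ (Fin n → ℝ) where
  carrier := {w | ∀ j < k, w ᵥ* (A ^ j * B) = 0}
  add_mem' hv hw j hj := by rw [add_vecMul, hv j hj, hw j hj, add_zero]
  zero_mem' j _ := zero_vecMul _
  smul_mem' c w hw j hj := by rw [smul_vecMul, hw j hj, smul_zero]

theorem ctrlAnnihilator_antitone : Antitone (ctrlAnnihilator A B) :=
  fun _ _ h _ hw j hj => hw j (hj.trans_le h)

theorem ctrlAnnihilator_zero : ctrlAnnihilator A B 0 = ⊤ :=
  eq_top_iff.2 fun _ _ j hj => absurd hj (Nat.not_lt_zero j)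

theorem ctrlRank_add_finrank_ctrlAnnihilator (k : ℕ) :
    ctrlRank A B k + Module.finrank ℝ (ctrlAnnihilator A B k) = n := by
  unfold ctrlRank
  set K : Matrix (Fin n) (Fin k × Fin r) ℝ := of fun i p => (A ^ (p.1 : ℕ) * B) i p.2 with hK
  have h1 : ctrlAnnihilator A B k = LinearMap.ker Kᵀ.mulVecLin := by
    ext w
    rw [LinearMap.mem_ker, mulVecLin_apply, mulVec_transpose]
    refine ⟨fun h => funext fun p => congrFun (h p.1 p.1.2) p.2, fun h j hj => funext fun b => ?_⟩
    exact congrFun h (⟨j, hj⟩, b)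
  rw [h1, ← rank_transpose, Matrix.rank, LinearMap.finrank_range_add_finrank_ker]
  simp

/-- By Cayley-Hamilton, `A ^ k` is a combination of `1, A, …, A ^ (n - 1)`. -/
theorem vecMul_pow_mul_eq_zero {w : Fin n → ℝ} (hw : w ∈ ctrlAnnihilator A B n) (k : ℕ) :
    w ᵥ* (A ^ k * B) = 0 := by
  rcases Nat.eq_zero_or_pos n with rfl | hn
  · rw [Subsingleton.elim w 0, zero_vecMul]
  have hdeg : (Polynomial.X ^ k %ₘ A.charpoly).natDegree < n := by
    have h1 := Polynomial.natDegree_modByMonic_lt (Polynomial.X ^ k) A.charpoly_monic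
      (fun h => by
        have := A.charpoly_natDegree_eq_dim
        rw [h] at this
        simp at this
        omega)
    rwa [A.charpoly_natDegree_eq_dim, Fintype.card_fin] at h1
  rw [pow_eq_aeval_mod_charpoly, Polynomial.aeval_eq_sum_range' hdeg, Matrix.sum_mul,
    vecMul_sum]
  refine Finset.sum_eq_zero fun i hi => ?_
  rw [Matrix.smul_mul, vecMul_smul, hw i (Finset.mem_range.1 hi), smul_zero]

/-- Solutions of linear differential equations with constant coefficients. -/
theorem exists_hasDerivAt_linear {E : Type*} [NormedAddCommGroup E] [NormedSpace ℝ E]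
    [CompleteSpace E] (L : E →L[ℝ] E) (w : E) :
    ∃ φ : ℝ → E, φ 0 = w ∧ ∀ t, HasDerivAt φ (L (φ t)) t :=
  ⟨fun t => NormedSpace.exp (t • L) w, by simp, fun t => by
    simpa using (hasDerivAt_exp_smul_const' L t).clm_apply (hasDerivAt_const t w)⟩

/-- One half of Kalman's criterion: if `w A ^ j B = 0` for all `j`, then the row vector
`φ t = w exp (-t A)` satisfies `φ t B = 0`, so that `φ t ⬝ᵥ x t` is constant along every
trajectory; a trajectory from `w` to the origin then gives `w ⬝ᵥ w = 0`. -/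
theorem ctrlAnnihilator_eq_bot (h : Controllable A B) : ctrlAnnihilator A B n = ⊥ := by
  rw [eq_bot_iff]
  intro w hw
  let E := ctrlAnnihilator A B n
  have hinv : ∀ v ∈ E, A.vecMulLinear v ∈ E := fun v hv j _ => by
    rw [vecMulLinear_apply, vecMul_vecMul, ← Matrix.mul_assoc, ← pow_succ']
    exact vecMul_pow_mul_eq_zero A B hv _
  -- the equation `φ' = -φ A` is solved in the invariant subspace `E`, so that `φ t B = 0`
  let L : E →L[ℝ] E := -(LinearMap.toContinuousLinearMap (A.vecMulLinear.restrict hinv))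
  obtain ⟨ψ, hψ0, hψ⟩ := exists_hasDerivAt_linear L ⟨w, hw⟩
  let φ : ℝ → Fin n → ℝ := fun t => ψ t
  have hφB : ∀ t, φ t ᵥ* B = 0 := fun t => by
    simpa using vecMul_pow_mul_eq_zero A B (ψ t).2 0
  have hφ : ∀ t, HasDerivAt φ (-(φ t ᵥ* A)) t := fun t =>
    E.subtypeL.hasFDerivAt.comp_hasDerivAt t (hψ t)
  obtain ⟨u, x, -, hx, hx0, hx1⟩ := h 0 1 one_pos w 0
  have hf : ∀ t ∈ Set.Icc (0 : ℝ) 1,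
      HasDerivWithinAt (fun t => φ t ⬝ᵥ x t) 0 (Set.Icc 0 1) t := fun t ht => by
    have h1 : HasDerivWithinAt (fun t => φ t ⬝ᵥ x t)
        (∑ i, ((-(φ t ᵥ* A)) i * x t i + φ t i * (A *ᵥ x t + B *ᵥ u t) i)) (Set.Icc 0 1) t :=
      HasDerivWithinAt.fun_sum fun i _ =>
        ((hasDerivAt_pi.1 (hφ t) i).hasDerivWithinAt).mul (hasDerivWithinAt_pi.1 (hx t ht) i)
    refine h1.congr_deriv ?_
    rw [Finset.sum_add_distrib]
    change -(φ t ᵥ* A) ⬝ᵥ x t + φ t ⬝ᵥ (A *ᵥ x t + B *ᵥ u t) = 0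
    rw [dotProduct_add, neg_dotProduct, dotProduct_mulVec, dotProduct_mulVec, hφB,
      zero_dotProduct]
    ring
  have hconst := constant_of_derivWithin_zero (fun t ht => (hf t ht).differentiableWithinAt)
    (fun t ht => (hf t (Set.Ico_subset_Icc_self ht)).derivWithin
      (uniqueDiffOn_Icc one_pos t (Set.Ico_subset_Icc_self ht))) 1 (by simp)
  have h0 : φ 0 = w := by simp [φ, hψ0]
  simp only [hx0, hx1, h0, dotProduct_zero] at hconst
  exact dotProduct_self_eq_zero.1 hconst.symm

theorem ctrlRank_eq (h : Controllable A B) : ctrlRank A B n = n := by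
  have := ctrlRank_add_finrank_ctrlAnnihilator A B n
  rwa [ctrlAnnihilator_eq_bot A B h, finrank_bot, add_zero] at this

theorem ctrlRank_ctrlIndex (h : Controllable A B) : ctrlRank A B (ctrlIndex A B) = n := by
  have : ctrlRank A B n = ctrlRank A B (ctrlIndex A B) :=
    Nat.sInf_mem (s := {k : ℕ | ctrlRank A B n = ctrlRank A B k}) ⟨n, rfl⟩
  rw [← this, ctrlRank_eq A B h]

theorem ctrlAnnihilator_ctrlIndex (h : Controllable A B) :
    ctrlAnnihilator A B (ctrlIndex A B) = ⊥ := by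
  have := ctrlRank_add_finrank_ctrlAnnihilator A B (ctrlIndex A B)
  rw [ctrlRank_ctrlIndex A B h] at this
  exact Submodule.finrank_eq_zero.1 (by omega)

theorem ctrlRank_mono : Monotone (ctrlRank A B) := fun i j hij => by
  have h1 := ctrlRank_add_finrank_ctrlAnnihilator A B i
  have h2 := ctrlRank_add_finrank_ctrlAnnihilator A B j
  have h3 := Submodule.finrank_mono (ctrlAnnihilator_antitone A B hij)
  omega

theorem ctrlRank_zero : ctrlRank A B 0 = 0 := by
  have := ctrlRank_add_finrank_ctrlAnnihilator A B 0
  rw [ctrlAnnihilator_zero, finrank_top, Module.finrank_fin_fun] at this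
  omega

/-- The vectors `w A ^ k B`, where the row vector `w` annihilates `B, …, A ^ (k - 1) B`. -/
def ctrlFlag (k : ℕ) : Submodule ℝ (Fin r → ℝ) :=
  (ctrlAnnihilator A B k).map (A ^ k * B).vecMulLinear

/-- The kernel of `w ↦ w A ^ k B` on the annihilator of `B, …, A ^ (k - 1) B` is the next
annihilator. -/
theorem finrank_ctrlFlag (k : ℕ) :
    Module.finrank ℝ (ctrlFlag A B k) = ctrlRank A B (k + 1) - ctrlRank A B k := by
  have h1 := ctrlRank_add_finrank_ctrlAnnihilator A B k
  have h2 := ctrlRank_add_finrank_ctrlAnnihilator A B (k + 1)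
  have h3 := LinearMap.finrank_range_add_finrank_ker
    ((A ^ k * B).vecMulLinear.domRestrict (ctrlAnnihilator A B k))
  have h4 : LinearMap.ker ((A ^ k * B).vecMulLinear.domRestrict (ctrlAnnihilator A B k)) =
      (ctrlAnnihilator A B (k + 1)).submoduleOf (ctrlAnnihilator A B k) := by
    ext ⟨w, hw⟩
    simp only [LinearMap.mem_ker, LinearMap.domRestrict_apply, vecMulLinear_apply,
      Submodule.submoduleOf, Submodule.mem_comap, Submodule.subtype_apply]
    refine ⟨fun h j hj => ?_, fun h => h k k.lt_succ_self⟩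
    rcases Nat.lt_succ_iff_lt_or_eq.1 hj with h' | rfl
    exacts [hw j h', h]
  rw [LinearMap.range_domRestrict, h4, (Submodule.submoduleOfEquivOfLe
    (ctrlAnnihilator_antitone A B (Nat.le_add_right k 1))).finrank_eq] at h3
  unfold ctrlFlag
  omega

/-- The vector that `w` gives at `k + 1` is given by `w A` at `k`. -/
theorem ctrlFlag_antitone : Antitone (ctrlFlag A B) := by
  refine antitone_nat_of_succ_le fun k => ?_
  rintro _ ⟨w, hw, rfl⟩
  refine ⟨w ᵥ* A, fun j hj => ?_, ?_⟩
  · rw [vecMul_vecMul, ← Matrix.mul_assoc, ← pow_succ']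
    exact hw (j + 1) (by omega)
  · rw [vecMulLinear_apply, vecMulLinear_apply, vecMul_vecMul, ← Matrix.mul_assoc, ← pow_succ']

theorem finrank_ctrlFlag_zero : Module.finrank ℝ (ctrlFlag A B 0) = B.rank := by
  rw [ctrlFlag, ctrlAnnihilator_zero, Submodule.map_top, pow_zero, Matrix.one_mul, ← rank_transpose,
    Matrix.rank, mulVecLin_transpose]

theorem ctrlFlag_zero (hB : B.rank = r) : ctrlFlag A B 0 = ⊤ :=
  Submodule.eq_top_of_finrank_eq (by rw [finrank_ctrlFlag_zero, hB, Module.finrank_fin_fun])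

/-- In the increasing flag `ctrlFlag (ν - i)`, the dimensions are the block sizes `l_i`; for `i = 0`
this is the rank condition for controllability. -/
theorem finrank_ctrlFlag_sub (h : Controllable A B) {i : ℕ} (hi : i ≤ ctrlIndex A B) :
    Module.finrank ℝ (ctrlFlag A B (ctrlIndex A B - i)) = blockSize A B i := by
  cases i with
  | zero =>
    rw [Nat.sub_zero, ctrlFlag, ctrlAnnihilator_ctrlIndex A B h, Submodule.map_bot, finrank_bot,
      blockSize]
  | succ i =>
    rw [finrank_ctrlFlag, blockSize]
    congr 2
    omega

theorem blockSize_le (h : Controllable A B) {i : ℕ} (hi : i ≤ ctrlIndex A B) :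
    blockSize A B i ≤ r := by
  rw [← finrank_ctrlFlag_sub A B h hi]
  simpa using Submodule.finrank_le (ctrlFlag A B (ctrlIndex A B - i))

theorem blockSize_mono (h : Controllable A B) {i j : ℕ} (hij : i ≤ j) (hj : j ≤ ctrlIndex A B) :
    blockSize A B i ≤ blockSize A B j := by
  rw [← finrank_ctrlFlag_sub A B h hj, ← finrank_ctrlFlag_sub A B h (hij.trans hj)]
  exact Submodule.finrank_mono (ctrlFlag_antitone A B (by omega))

theorem blockSize_ctrlIndex (hB : B.rank = r) (h : Controllable A B) :
    blockSize A B (ctrlIndex A B) = r := by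
  rw [← finrank_ctrlFlag_sub A B h le_rfl, Nat.sub_self, finrank_ctrlFlag_zero, hB]

theorem sum_blockSize (h : Controllable A B) :
    ∑ i ∈ Finset.range (ctrlIndex A B + 1), blockSize A B i = n := by
  have key : ∀ k ≤ ctrlIndex A B, ∑ i ∈ Finset.range (k + 1), blockSize A B i =
      ctrlRank A B (ctrlIndex A B) - ctrlRank A B (ctrlIndex A B - k) := fun k hk => by
    induction k with
    | zero => simp [blockSize]
    | succ k ih =>
      rw [Finset.sum_range_succ, ih (by omega), blockSize]
      have h1 := ctrlRank_mono A B (show ctrlIndex A B - k ≤ ctrlIndex A B by omega)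
      have h2 := ctrlRank_mono A B (show ctrlIndex A B - (k + 1) ≤ ctrlIndex A B - k by omega)
      omega
  rw [key _ le_rfl, Nat.sub_self, ctrlRank_zero, ctrlRank_ctrlIndex A B h, Nat.sub_zero]

end Kalman

/-! ### Existence of Yokoyama's canonical form -/

section Yokoyama

open Matrix

variable {n r : ℕ} (A : Matrix (Fin n) (Fin n) ℝ) (B : Matrix (Fin n) (Fin r) ℝ)

theorem card_stateIdx (h : Controllable A B) : Fintype.card (StateIdx A B) = n := by
  rw [Fintype.card_sigma]
  simp only [Fintype.card_fin]
  rw [Fin.sum_univ_eq_sum_range (fun i => blockSize A B i), sum_blockSize A B h]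

theorem det_eq_one_of_unitriangular {r : ℕ} {R : Type*} [CommRing R]
    (G : Matrix (Fin r) (Fin r) R) (h₀ : ∀ a b, a < b → G a b = 0) (h₁ : ∀ a, G a a = 1) :
    G.det = 1 := by
  rw [det_of_isLowerTriangular G (fun a b hab => h₀ a b hab)]
  exact Finset.prod_eq_one fun a _ => h₁ a

/-- If the vectors `w (ν, ·)` have linearly independent values under `B`, and the vectors
`w (i, ·)` with `i < ν` are annihilated by `B` and shifted by `A` to members of `w (i + 1, ·)`,
then all the `w` are linearly independent: the values of `Σ c w` under `B, A B, A ^ 2 B, …` kill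
the coefficients of level `ν`, `ν - 1`, `ν - 2`, …. -/
theorem eq_zero_of_sum_chains {ν : ℕ} {l : ℕ → ℕ} (hl : ∀ i ≤ ν, l i ≤ r)
    (N : Matrix (Σ i : Fin (ν + 1), Fin (l i)) (Fin n) ℝ) (g : Fin r → Fin r → ℝ)
    (hg : LinearIndependent ℝ g)
    (hN₀ : ∀ p (j : ℕ), (p.1 : ℕ) + j < ν → N p ᵥ* (A ^ j * B) = 0)
    (hN₁ : ∀ p (j : ℕ), (p.1 : ℕ) + j = ν → ∀ a : Fin r, (a : ℕ) + l p.1 = p.2 + r →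
      N p ᵥ* (A ^ j * B) = g a)
    (c : (Σ i : Fin (ν + 1), Fin (l i)) → ℝ) (hc : c ᵥ* N = 0) : c = 0 := by
  have hsum : ∀ j : ℕ, ∑ p, c p • (N p ᵥ* (A ^ j * B)) = 0 := fun j => by
    have := congrArg (· ᵥ* (A ^ j * B)) hc
    simp only [zero_vecMul] at this
    rw [← this, vecMul_eq_sum c N, sum_vecMul]
    simp only [smul_vecMul]
  have key : ∀ j : ℕ, ∀ p, (p.1 : ℕ) + j = ν → c p = 0 := by
    intro j
    induction j using Nat.strong_induction_on with
    | _ j ih =>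
      rintro ⟨i, b⟩ hi
      have h1 := hsum j
      rw [Fintype.sum_sigma, Finset.sum_eq_single i] at h1
      · have hli : l i ≤ r := hl i (by omega)
        let ι : Fin (l i) → Fin r := fun b => ⟨b + (r - l i), by omega⟩
        have hι : Function.Injective ι := fun b b' hbb => by
          have := congrArg Fin.val hbb
          simp only [ι] at this
          exact Fin.ext (by omega)
        have h2 := Fintype.linearIndependent_iff.1 (hg.comp ι hι) (fun b => c ⟨i, b⟩)
        refine h2 ?_ b
        rw [← h1]
        refine Finset.sum_congr rfl fun b _ => ?_
        rw [hN₁ ⟨i, b⟩ j hi (ι b) (by simp only [ι]; omega)]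
        rfl
      · intro i' _ hne
        refine Finset.sum_eq_zero fun b' _ => ?_
        have hne' : (i' : ℕ) ≠ i := fun h => hne (Fin.ext h)
        rcases Nat.lt_or_ge ((i' : ℕ) + j) ν with h | h
        · rw [hN₀ ⟨i', b'⟩ j h, smul_zero]
        · rw [ih (ν - i') (by simp only at hi; omega) ⟨i', b'⟩ (by simp only; omega), zero_smul]
      · simp
  exact funext fun p => key (ν - p.1) p (by have := p.1.2; omega)

/-- Yokoyama's form exists. The rows of `N` are chains `w a, w a A, w a A ^ 2, …`, where `w a`
produces the vector `g a` of an echelon basis adapted to the flag `ctrlFlag`, and the chain starts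
in the block `d a` in which `g a` first occurs. -/
theorem exists_isYokoyama (hB : B.rank = r) (h : Controllable A B) :
    ∃ (N : Matrix (StateIdx A B) (Fin n) ℝ) (T : Matrix (Fin n) (StateIdx A B) ℝ)
      (σ : Equiv.Perm (Fin r)), IsYokoyama A B N T σ := by
  obtain ⟨σ, g, d, hgd⟩ := exists_echelon_basis_of_flag (ctrlIndex A B)
    (fun i => ctrlFlag A B (ctrlIndex A B - i))
    (fun i j hij => ctrlFlag_antitone A B (by omega))
    (by simpa using ctrlFlag_zero A B hB)
  choose hdν hgR hdi hgσ using hgd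
  have hpos : ∀ (a : Fin r) (i : ℕ), i ≤ ctrlIndex A B →
      (r ≤ a + blockSize A B i ↔ d a ≤ i) := fun a i hi => by
    rw [← hdi a i, finrank_ctrlFlag_sub A B h hi]
  have hg₁ : ∀ a b : Fin r, r ≤ b + blockSize A B (d a) →
      g a (σ b) = if a = b then 1 else 0 := fun a b hb =>
    hgσ a b (by rwa [finrank_ctrlFlag_sub A B h (hdν a)])
  have hself : ∀ a : Fin r, r ≤ a + blockSize A B (d a) := fun a => (hpos a _ (hdν a)).2 le_rfl
  choose w hwW hw using hgR
  simp only [vecMulLinear_apply] at hw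
  have hle : ∀ i : Fin (ctrlIndex A B + 1), blockSize A B i ≤ r := fun i =>
    blockSize_le A B h (by omega)
  -- blocks are aligned on the right: position `b` of block `i` continues the chain of `pos ⟨i, b⟩`
  let pos : StateIdx A B → Fin r := fun p =>
    ⟨p.2 + (r - blockSize A B p.1), by have := p.2.2; have := hle p.1; omega⟩
  have hpos' : ∀ p, (pos p : ℕ) + blockSize A B p.1 = p.2 + r := fun p => by
    have := hle p.1
    simp only [pos]
    omega
  have hd : ∀ p, d (pos p) ≤ p.1 := fun p =>
    (hpos _ _ (by have := p.1.2; omega)).1 (by have := hpos' p; omega)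
  let N : Matrix (StateIdx A B) (Fin n) ℝ := of fun p => w (pos p) ᵥ* A ^ ((p.1 : ℕ) - d (pos p))
  have hN : ∀ p, N p = w (pos p) ᵥ* A ^ ((p.1 : ℕ) - d (pos p)) := fun p => rfl
  have hNj : ∀ p (j : ℕ), N p ᵥ* (A ^ j * B) = w (pos p) ᵥ* (A ^ (p.1 - d (pos p) + j) * B) :=
    fun p j => by rw [hN, vecMul_vecMul, ← Matrix.mul_assoc, ← pow_add]
  have hN₀ : ∀ p (j : ℕ), (p.1 : ℕ) + j < ctrlIndex A B → N p ᵥ* (A ^ j * B) = 0 :=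
    fun p j hj => by
      have := hd p
      rw [hNj]
      exact hwW (pos p) _ (by omega)
  have hN₁ : ∀ p (j : ℕ), (p.1 : ℕ) + j = ctrlIndex A B → N p ᵥ* (A ^ j * B) = g (pos p) :=
    fun p j hj => by
      have := hd p
      rw [hNj, ← hw]
      congr 3
      omega
  have hgli : LinearIndependent ℝ g := by
    have hdet : (of fun a b => g a (σ b)).det = 1 := by
      apply det_eq_one_of_unitriangular
      · intro a b hab
        have := hself a
        have hab' : (a : ℕ) < b := hab
        rw [of_apply, hg₁ a b (by omega), if_neg hab.ne]
      · intro a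
        rw [of_apply, hg₁ a a (hself a), if_pos rfl]
    have h1 := linearIndependent_rows_iff_isUnit.2
      ((isUnit_iff_isUnit_det _).2 (hdet ▸ isUnit_one))
    exact LinearIndependent.of_comp (LinearMap.funLeft ℝ ℝ σ) h1
  have hinj : ∀ c, c ᵥ* N = 0 → c = 0 :=
    eq_zero_of_sum_chains A B (ν := ctrlIndex A B) (l := blockSize A B)
      (fun i hi => blockSize_le A B h hi) N g hgli hN₀ (fun p j hj a ha => by
        rw [hN₁ p j hj]
        congr 1
        exact Fin.ext (by have := hpos' p; omega))
  let e : StateIdx A B ≃ Fin n := Fintype.equivFinOfCardEq (card_stateIdx A B h)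
  have hunit : IsUnit (N.submatrix e.symm id) := by
    rw [← vecMul_injective_iff_isUnit]
    have h1 : Function.Injective (N.submatrix e.symm id).vecMulLinear := by
      rw [injective_iff_map_eq_zero]
      intro c hc
      have h2 : (c ∘ e) ᵥ* N = 0 := by
        rw [← hc, vecMulLinear_apply]
        ext j
        simp only [vecMul, dotProduct, submatrix_apply, id]
        exact Fintype.sum_equiv e _ _ fun p => by simp
      have h3 := hinj _ h2
      exact funext fun i => by simpa using congrFun h3 (e.symm i)
    exact h1
  have hN₂ : N * ((N.submatrix e.symm id)⁻¹.submatrix id e) = 1 := by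
    have h1 := mul_nonsing_inv _ ((isUnit_iff_isUnit_det _).1 hunit)
    have h2 := congrArg (fun M => M.submatrix e e) h1
    simp only [submatrix_one_equiv] at h2
    rw [← h2, ← submatrix_mul_equiv _ _ _ (Equiv.refl _) _]
    simp
  have hNA : ∀ p q : StateIdx A B, (q.1 : ℕ) = p.1 + 1 → pos q = pos p → N p ᵥ* A = N q :=
    fun p q hpq hq => by
      have := hd p
      rw [hN, hN, hq, vecMul_vecMul, ← pow_succ]
      congr 2
      omega
  have hG : ∀ p b, (N * B * σ⁻¹.permMatrix ℝ) p b = (N p ᵥ* (A ^ 0 * B)) (σ b) := fun p b => by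
    have h1 : (N * B * σ⁻¹.permMatrix ℝ) p = (N p ᵥ* B) ᵥ* σ⁻¹.permMatrix ℝ := by
      rw [mul_apply_eq_vecMul, mul_apply_eq_vecMul]
    rw [h1, vecMul_permMatrix, pow_zero, Matrix.one_mul]
    rfl
  have hG₁ : ∀ (p : StateIdx A B) b, (p.1 : ℕ) = ctrlIndex A B →
      (pos p : ℕ) = p.2 ∧ (N * B * σ⁻¹.permMatrix ℝ) p b = g (pos p) (σ b) := fun p b hp => by
    refine ⟨?_, by rw [hG, hN₁ p 0 hp]⟩
    have h1 := hpos' p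
    have h2 := blockSize_ctrlIndex A B hB h
    rw [← hp] at h2
    omega
  refine ⟨N, (N.submatrix e.symm id)⁻¹.submatrix id e, σ⁻¹, hN₂, ?_, ?_, ?_, ?_, ?_, ?_⟩
  · exact (mul_eq_one_comm_of_card_eq _ _ _ (by simp [card_stateIdx A B h])).1 hN₂
  · intro p q hp
    -- row `p` of `N * A` is the row of `N` in the next block with the same right alignment
    have hm := blockSize_mono A B h (Nat.le_add_right (p.1 : ℕ) 1) hp
    let p' : StateIdx A B := ⟨⟨p.1 + 1, by omega⟩,
      ⟨p.2 + (blockSize A B (p.1 + 1) - blockSize A B p.1), by have := p.2.2; simp only; omega⟩⟩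
    have hr := blockSize_le A B h (i := p.1 + 1) hp
    have hp' : pos p' = pos p := Fin.ext (by simp only [pos, p']; omega)
    have h1 : (N * A * (N.submatrix e.symm id)⁻¹.submatrix id e) p q =
        (1 : Matrix (StateIdx A B) (StateIdx A B) ℝ) p' q := by
      rw [← hN₂, mul_apply_eq_vecMul, mul_apply_eq_vecMul, mul_apply_eq_vecMul,
        hNA p p' rfl hp']
    rw [h1, one_apply]
    obtain ⟨⟨i, hi⟩, b⟩ := q
    by_cases hiq : i = p.1 + 1
    · subst hiq
      have hb := b.2
      simp only [p', rightId, of_apply, if_true]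
      refine if_congr ?_ rfl rfl
      rw [Sigma.mk.injEq]
      simp only [heq_eq_eq, true_and, Fin.ext_iff]
      omega
    · rw [if_neg hiq, if_neg]
      intro hpq
      exact hiq (congrArg (fun q : StateIdx A B => (q.1 : ℕ)) hpq).symm
  · intro p b hp
    rw [hG, hN₀ p 0 (by omega)]
    rfl
  · intro p b hp hlt
    obtain ⟨h1, h2⟩ := hG₁ p b hp
    have := hself (pos p)
    rw [h2, hg₁ _ _ (by omega), if_neg]
    rintro rfl
    omega
  · intro p b hp heq
    obtain ⟨h1, h2⟩ := hG₁ p b hp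
    have hb : pos p = b := Fin.ext (by omega)
    rw [h2, hb, hg₁ _ _ (hself b), if_pos rfl]
  · intro p b hp hne hj
    obtain ⟨h1, h2⟩ := hG₁ p b hp
    have := hself (pos p)
    have := hj (d (pos p)) (hdν _)
    rw [h2, hg₁ _ _ (by omega), if_neg]
    rintro rfl
    omega

end Yokoyama

/-! ### The determinant of the pencil in Yokoyama's coordinates -/

section Determinant

open Matrix Polynomial

/-- Splitting the last block off an index type of blocks. -/
noncomputable def sigmaFinSuccEquiv (l : ℕ → ℕ) (m : ℕ) :
    (Σ i : Fin m, Fin (l i)) ⊕ Fin (l m) ≃ Σ i : Fin (m + 1), Fin (l i) :=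
  Equiv.ofBijective
    (Sum.elim (fun p => ⟨p.1.castSucc, p.2⟩) (fun b => ⟨Fin.last m, b⟩)) <| by
  constructor
  · rintro (⟨i, b⟩ | b) (⟨i', b'⟩ | b') h
    · simp only [Sum.elim_inl, Sigma.mk.injEq] at h
      obtain ⟨h1, h2⟩ := h
      obtain rfl := Fin.castSucc_injective _ h1
      rw [eq_of_heq h2]
    · exact absurd (congrArg Sigma.fst h) (Fin.castSucc_ne_last i)
    · exact absurd (congrArg Sigma.fst h).symm (Fin.castSucc_ne_last i')
    · simpa using h
  · rintro ⟨i, b⟩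
    rcases Fin.eq_castSucc_or_eq_last i with ⟨j, rfl⟩ | rfl
    · exact ⟨Sum.inl ⟨j, b⟩, rfl⟩
    · exact ⟨Sum.inr b, rfl⟩

/-- The determinant identity between pencil and system matrix, for blocks over a commutative ring:
the rows `[S₂₁, S₂₂, G]` are eliminated first, then the columns of `C₂`. -/
theorem associated_det_fromBlocks {h k ι R : Type*} [Fintype h] [DecidableEq h] [Fintype k]
    [DecidableEq k] [Fintype ι] [DecidableEq ι] [CommRing R] (s : R) (H : Matrix h h R)
    (E₁ : Matrix h k R) (E₂ : Matrix k ι R) (C₁ : Matrix ι h R) (C₂ : Matrix ι k R)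
    (C₃ S₂₂ G : Matrix ι ι R) (S₂₁ : Matrix ι (h ⊕ k) R) (hG : IsUnit G.det) :
    Associated
      (s ^ Fintype.card k * (fromBlocks H (-(E₁ * E₂)) C₁ (C₂ * E₂ + s • C₃)).det)
      (s ^ Fintype.card ι *
        (fromBlocks (fromBlocks (fromBlocks H (-E₁) 0 (s • 1)) (fromRows 0 (-E₂)) S₂₁ S₂₂)
          (fromRows 0 G) (fromCols (fromCols C₁ C₂) C₃) 0).det) := by
  obtain ⟨ε, h2⟩ := det_border_swap (fromBlocks H (-E₁) 0 (s • 1)) (fromRows 0 (-E₂)) S₂₁ S₂₂ G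
    (fromCols C₁ C₂) C₃
  rw [h2, ← det_mul_pow_eq_pow_mul_det]
  have hu : IsUnit (((ε : ℤ) : R) * G.det) :=
    ((ε.isUnit).map (Int.castRingHom R)).mul hG
  refine ⟨hu.unit, ?_⟩
  rw [IsUnit.unit_spec]
  ring

/-- The block matrix whose only nonzero blocks are `[O, I]`, right above the diagonal. -/
def shiftMatrix (l : ℕ → ℕ) (m : ℕ) :
    Matrix (Σ i : Fin m, Fin (l i)) (Σ i : Fin m, Fin (l i)) ℝ :=
  of fun p q => if (q.1 : ℕ) = (p.1 : ℕ) + 1 then rightId (l p.1) (l q.1) p.2 q.2 else 0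

/-- The block column whose only nonzero block is `[O, I]`, in the last block row. -/
def shiftTail (l : ℕ → ℕ) (m q : ℕ) : Matrix (Σ i : Fin m, Fin (l i)) (Fin q) ℝ :=
  of fun p b => if (p.1 : ℕ) + 1 = m then rightId (l p.1) q p.2 b else 0

theorem shiftTail_mul_rightId {l : ℕ → ℕ} {m q : ℕ} (hl : ∀ i < m, l i ≤ l m) :
    shiftTail l m (l m) * rightId (l m) q = shiftTail l m q := by
  ext p b
  rw [mul_apply]
  simp only [shiftTail, of_apply]
  split_ifs with hp
  · rw [← rightId_mul_rightId (t := q) (hl p.1 p.1.2), mul_apply]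
  · simp

theorem rightId_self (q : ℕ) : rightId q q = 1 := by
  ext a b
  simp [rightId, one_apply, Fin.ext_iff, eq_comm]

section Companion

variable {l : ℕ → ℕ} {m r : ℕ}
  (F : Matrix (Σ i : Fin (m + 2), Fin (l i)) (Σ i : Fin (m + 2), Fin (l i)) ℝ)

/-- The splitting of the state into the blocks `0, …, m - 1`, the block `m` and the block
`m + 1`. -/
noncomputable def splitEquiv (l : ℕ → ℕ) (m : ℕ) :
    ((Σ i : Fin m, Fin (l i)) ⊕ Fin (l m)) ⊕ Fin (l (m + 1)) ≃ Σ i : Fin (m + 2), Fin (l i) :=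
  (Equiv.sumCongr (sigmaFinSuccEquiv l m) (Equiv.refl (Fin (l (m + 1))))).trans
    (sigmaFinSuccEquiv l (m + 1))

@[simp]
theorem splitEquiv_inl_inl (p : Σ i : Fin m, Fin (l i)) :
    splitEquiv l m (Sum.inl (Sum.inl p)) = ⟨p.1.castSucc.castSucc, p.2⟩ := rfl

@[simp]
theorem splitEquiv_inl_inr (b : Fin (l m)) :
    splitEquiv l m (Sum.inl (Sum.inr b)) = ⟨(Fin.last m).castSucc, b⟩ := rfl

@[simp]
theorem splitEquiv_inr (b : Fin (l (m + 1))) :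
    splitEquiv l m (Sum.inr b) = ⟨Fin.last (m + 1), b⟩ := rfl

/-- All block rows but the last one of a matrix in Yokoyama's form. -/
theorem submatrix_splitEquiv
    (hF : ∀ p q, (p.1 : ℕ) < m + 1 →
      F p q = if (q.1 : ℕ) = (p.1 : ℕ) + 1 then rightId (l p.1) (l q.1) p.2 q.2 else 0) :
    F.submatrix (splitEquiv l m) (splitEquiv l m) =
      fromBlocks (fromBlocks (shiftMatrix l m) (shiftTail l m (l m)) 0 0)
        (fromRows 0 (rightId (l m) (l (m + 1))))
        (F.submatrix (splitEquiv l m ∘ Sum.inr) (splitEquiv l m ∘ Sum.inl))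
        (F.submatrix (splitEquiv l m ∘ Sum.inr) (splitEquiv l m ∘ Sum.inr)) := by
  ext1 i j
  rw [submatrix_apply]
  rcases i with (i | i) | i
  · have hi : (i.1 : ℕ) < m := i.1.2
    rw [hF _ _ (by simp only [splitEquiv_inl_inl, Fin.val_castSucc]; omega)]
    rcases j with (j | j) | j
    · simp [shiftMatrix]
      rfl
    · simp [shiftTail, eq_comm]
      rfl
    · simp
      intro h
      omega
  · rcases j with (j | j) | j
    · have hj : (j.1 : ℕ) < m := j.1.2
      refine (hF _ _ (by simp)).trans (if_neg ?_)
      change ¬ (j.1 : ℕ) = m + 1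
      omega
    · rw [hF _ _ (by simp)]
      simp
    · rw [hF _ _ (by simp)]
      simp
  · rcases j with j | j <;> rfl

theorem charmatrix_submatrix_splitEquiv
    (hF : ∀ p q, (p.1 : ℕ) < m + 1 →
      F p q = if (q.1 : ℕ) = (p.1 : ℕ) + 1 then rightId (l p.1) (l q.1) p.2 q.2 else 0) :
    ∃ S₂₁ S₂₂, (charmatrix F).submatrix (splitEquiv l m) (splitEquiv l m) =
      fromBlocks
        (fromBlocks (charmatrix (shiftMatrix l m)) (-((shiftTail l m (l m)).map C)) 0
          ((X : ℝ[X]) • 1))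
        (fromRows 0 (-((rightId (l m) (l (m + 1))).map C))) S₂₁ S₂₂ := by
  have h1 := charmatrix_reindex (splitEquiv l m).symm (M := F)
  simp only [reindex_apply, Equiv.symm_symm] at h1
  rw [← h1, submatrix_splitEquiv F hF, charmatrix_fromBlocks, charmatrix_fromBlocks]
  refine ⟨-(F.submatrix (splitEquiv l m ∘ Sum.inr) (splitEquiv l m ∘ Sum.inl)).map C,
    charmatrix (F.submatrix (splitEquiv l m ∘ Sum.inr) (splitEquiv l m ∘ Sum.inr)), ?_⟩
  congr 2
  · simp
  · ext1 i j
    simp [charmatrix, diagonal_apply, one_apply]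
  · ext1 (i | i) j <;> simp

end Companion

theorem pencil_eq_fromBlocks {h k ι : Type} [Fintype h] [DecidableEq h] [Fintype k]
    [DecidableEq k] [Fintype ι] [DecidableEq ι] (S : Matrix h h ℝ) (E₁ : Matrix h k ℝ)
    (E₂ : Matrix k ι ℝ) (C₁ : Matrix ι h ℝ) (C₂ : Matrix ι k ℝ) (C₃ : Matrix ι ι ℝ) :
    pencil (fromBlocks 1 0 0 C₃) (fromBlocks (-S) (-(E₁ * E₂)) C₁ (C₂ * E₂)) =
      fromBlocks (charmatrix S) (-(E₁.map C * E₂.map C)) (C₁.map C)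
        (C₂.map C * E₂.map C + (X : ℝ[X]) • C₃.map C) := by
  rw [pencil, ← Matrix.map_mul, ← Matrix.map_mul, fromBlocks_map,
    fromBlocks_map, fromBlocks_smul, fromBlocks_add]
  congr 1
  · ext1 i j
    simp [charmatrix_apply, smul_eq_diagonal_mul, sub_eq_add_neg]
  · ext1 i j
    simp [-Matrix.map_mul]
  · simp
  · exact add_comm _ _

/-- The determinant of the pencil and that of the system matrix in Yokoyama's coordinates. The
pencil is `zeroPencil`, written out for arbitrary block sizes `l` so that `ν` can be replaced by a
successor. -/
theorem associated_det_pencil {ν r : ℕ} {l : ℕ → ℕ} (hν : 0 < ν) (hr : l ν = r)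
    (hl : ∀ i j, i ≤ j → j ≤ ν → l i ≤ l j)
    (F : Matrix (Σ i : Fin (ν + 1), Fin (l i)) (Σ i : Fin (ν + 1), Fin (l i)) ℝ)
    (G : Matrix (Σ i : Fin (ν + 1), Fin (l i)) (Fin r) ℝ)
    (K : Matrix (Fin r) (Σ i : Fin (ν + 1), Fin (l i)) ℝ)
    (hF : ∀ p q, (p.1 : ℕ) < ν →
      F p q = if (q.1 : ℕ) = (p.1 : ℕ) + 1 then rightId (l p.1) (l q.1) p.2 q.2 else 0)
    (hG : ∀ p b, (p.1 : ℕ) < ν → G p b = 0)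
    (hG₀ : ∀ p (b : Fin r), (p.1 : ℕ) = ν → (p.2 : ℕ) < (b : ℕ) → G p b = 0)
    (hG₁ : ∀ p (b : Fin r), (p.1 : ℕ) = ν → (p.2 : ℕ) = (b : ℕ) → G p b = 1) :
    Associated (X ^ l (ν - 1) * (pencil
        (fromBlocks 1 0 0 ((of fun a (b : Fin (l ν)) => K a ⟨Fin.last ν, b⟩) * rightId (l ν) r))
        (fromBlocks
          (-(of fun p q : Σ i : Fin (ν - 1), Fin (l i) =>
            if (q.1 : ℕ) = (p.1 : ℕ) + 1 then rightId (l p.1) (l q.1) p.2 q.2 else 0))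
          (-(of fun p b => if (p.1 : ℕ) + 2 = ν then rightId (l p.1) r p.2 b else 0))
          (of fun a q => K a ⟨⟨q.1, by have := q.1.isLt; omega⟩, q.2⟩)
          ((of fun a b => K a ⟨⟨ν - 1, by omega⟩, b⟩) * rightId (l (ν - 1)) r))).det)
      (X ^ r * (fromBlocks (charmatrix F) (-(G.map C)) (K.map C) 0).det) := by
  subst hr
  obtain ⟨m, rfl⟩ : ∃ m, ν = m + 1 := ⟨ν - 1, by omega⟩
  let e := Equiv.sumCongr (splitEquiv l m) (Equiv.refl (Fin (l (m + 1))))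
  let G₂ : Matrix (Fin (l (m + 1))) (Fin (l (m + 1))) ℝ := of fun a b => G ⟨Fin.last (m + 1), a⟩ b
  let C₁ : Matrix (Fin (l (m + 1))) (Σ i : Fin m, Fin (l i)) ℝ :=
    of fun a q => K a ⟨⟨q.1, by have := q.1.isLt; omega⟩, q.2⟩
  let C₂ : Matrix (Fin (l (m + 1))) (Fin (l m)) ℝ := of fun a b => K a ⟨⟨m, by omega⟩, b⟩
  let C₃ : Matrix (Fin (l (m + 1))) (Fin (l (m + 1))) ℝ :=
    of fun a b => K a ⟨Fin.last (m + 1), b⟩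
  have hdetG : IsUnit (-(G₂.map C)).det := by
    have h1 : G₂.det = 1 := det_eq_one_of_unitriangular G₂
      (fun a b hab => hG₀ ⟨Fin.last (m + 1), a⟩ b rfl hab)
      (fun a => hG₁ ⟨Fin.last (m + 1), a⟩ a rfl rfl)
    have h2 : (G₂.map C).det = C G₂.det := by rw [RingHom.map_det]; rfl
    rw [det_neg, h2, h1, C_1, mul_one]
    exact isUnit_one.neg.pow _
  obtain ⟨S₂₁, S₂₂, hS⟩ := charmatrix_submatrix_splitEquiv F hF
  have hP : (fromBlocks (charmatrix F) (-(G.map C)) (K.map C) 0).submatrix e e =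
      fromBlocks (fromBlocks (fromBlocks (charmatrix (shiftMatrix l m))
          (-((shiftTail l m (l m)).map C)) 0 ((X : ℝ[X]) • 1))
          (fromRows 0 (-((rightId (l m) (l (m + 1))).map C))) S₂₁ S₂₂)
        (fromRows 0 (-(G₂.map C)))
        (fromCols (fromCols (C₁.map C) (C₂.map C)) (C₃.map C)) 0 := by
    rw [← hS]
    ext1 (i | i) (j | j)
    · rfl
    · rcases i with (i | i) | i
      · have h0 := hG ⟨i.1.castSucc.castSucc, i.2⟩ j (by simp only [Fin.val_castSucc]; omega)
        change -(C (G ⟨i.1.castSucc.castSucc, i.2⟩ j)) = 0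
        rw [h0, C_0, neg_zero]
      · have h0 := hG ⟨(Fin.last m).castSucc, i⟩ j (by simp)
        change -(C (G ⟨(Fin.last m).castSucc, i⟩ j)) = 0
        rw [h0, C_0, neg_zero]
      · rfl
    · rcases j with (j | j) | j <;> rfl
    · rfl
  have h1 := associated_det_fromBlocks (X : ℝ[X]) (charmatrix (shiftMatrix l m))
    ((shiftTail l m (l m)).map C) ((rightId (l m) (l (m + 1))).map C) (C₁.map C) (C₂.map C)
    (C₃.map C) S₂₂ (-(G₂.map C)) S₂₁ hdetG
  rw [← hP, det_submatrix_equiv_self, ← pencil_eq_fromBlocks, Fintype.card_fin, Fintype.card_fin,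
    shiftTail_mul_rightId (fun i hi => hl i m hi.le (by omega))]
    at h1
  rw [rightId_self, Matrix.mul_one]
  have h2 : (of fun (p : Σ i : Fin m, Fin (l i)) (b : Fin (l (m + 1))) =>
      if (p.1 : ℕ) + 2 = m + 1 then rightId (l p.1) (l (m + 1)) p.2 b else 0) =
      shiftTail l m (l (m + 1)) := by
    ext1 p b
    simp only [of_apply, shiftTail]
    exact if_congr (by omega) rfl rfl
  change Associated (X ^ l m * (pencil (fromBlocks 1 0 0 C₃) (fromBlocks (-shiftMatrix l m)
    (-(of fun (p : Σ i : Fin m, Fin (l i)) (b : Fin (l (m + 1))) =>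
      if (p.1 : ℕ) + 2 = m + 1 then rightId (l p.1) (l (m + 1)) p.2 b else 0))
    C₁ (C₂ * rightId (l m) (l (m + 1))))).det) _
  rw [h2]
  exact h1

end Determinant

/-! ### Zero polynomial and generalized eigenvalues -/

section ZeroPolynomial

open Matrix Polynomial

variable {n r : ℕ} (A : Matrix (Fin n) (Fin n) ℝ) (B : Matrix (Fin n) (Fin r) ℝ)
  (C : Matrix (Fin r) (Fin n) ℝ)

theorem orderEmbedding_eq_refl (f : Fin r ↪o Fin r) : f = RelEmbedding.refl _ := by
  apply DFunLike.coe_injective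
  exact (f.strictMono.range_inj strictMono_id).1 <| by
    rw [(Finite.injective_iff_surjective.1 f.injective).range_eq]
    exact (Set.range_id).symm

theorem systemMinor_eq_det (f g : Fin r ↪o Fin r) :
    systemMinor A B C f g = (systemMatrix A B C).det := by
  rw [orderEmbedding_eq_refl f, orderEmbedding_eq_refl g, systemMinor]
  congr 1
  ext1 (i | i) (j | j) <;> rfl

theorem maxMinorSize_eq (h : (systemMatrix A B C).det ≠ 0) : maxMinorSize A B C = r := by
  have : IsGreatest {k : ℕ | ∃ (f : Fin k ↪o Fin r) (g : Fin k ↪o Fin r),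
      systemMinor A B C f g ≠ 0} r := by
    refine ⟨⟨RelEmbedding.refl _, RelEmbedding.refl _, ?_⟩, ?_⟩
    · rwa [systemMinor_eq_det]
    · rintro k ⟨f, -, -⟩
      simpa using Fintype.card_le_of_injective f f.injective
  exact this.csSup_eq

/-- If the square system matrix is nonsingular, it is its only minor of maximal order. -/
theorem associated_zeroPolynomial (h : (systemMatrix A B C).det ≠ 0) :
    Associated (zeroPolynomial A B C) (systemMatrix A B C).det := by
  have hset : ∀ k, k = r → {p : ℝ[X] | ∃ (f : Fin k ↪o Fin r) (g : Fin k ↪o Fin r),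
      p = systemMinor A B C f g} = {(systemMatrix A B C).det} := by
    rintro k rfl
    ext p
    simp only [systemMinor_eq_det, Set.mem_ofPred_eq, Set.mem_singleton_iff]
    exact ⟨fun ⟨_, _, hp⟩ => hp, fun hp => ⟨RelEmbedding.refl _, RelEmbedding.refl _, hp⟩⟩
  unfold zeroPolynomial
  simp only [hset _ (maxMinorSize_eq A B C h)]
  exact Submodule.IsPrincipal.associated_generator_span_self _

theorem aroots_eq_of_associated {p q : ℝ[X]} (h : Associated p q) : p.aroots ℂ = q.aroots ℂ :=
  (h.map (mapRingHom (algebraMap ℝ ℂ))).roots_eq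

theorem systemZeros_eq (h : (systemMatrix A B C).det ≠ 0) :
    systemZeros A B C = (systemMatrix A B C).det.aroots ℂ :=
  aroots_eq_of_associated (associated_zeroPolynomial A B C h)

variable {A B C}

/-- A change of state and a permutation of the inputs do not affect the determinant of the system
matrix, up to sign. -/
theorem associated_det_systemMatrix {S : Type*} [Fintype S] [DecidableEq S]
    {N : Matrix S (Fin n) ℝ} {T : Matrix (Fin n) S ℝ} (hNT : N * T = 1) (hTN : T * N = 1)
    (σ : Equiv.Perm (Fin r)) :
    Associated (systemMatrix A B C).det
      (fromBlocks (charmatrix (N * A * T)) (-((N * B * σ.permMatrix ℝ).map Polynomial.C))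
        ((C * T).map Polynomial.C) 0).det := by
  have hNT' : N.map Polynomial.C * T.map Polynomial.C = 1 := by
    rw [← Matrix.map_mul, hNT]
    simp
  have hTN' : T.map Polynomial.C * N.map Polynomial.C = 1 := by
    rw [← Matrix.map_mul, hTN]
    simp
  let N' : Matrix (S ⊕ Fin r) (Fin n ⊕ Fin r) ℝ[X] := fromBlocks (N.map Polynomial.C) 0 0 1
  let T' : Matrix (Fin n ⊕ Fin r) (S ⊕ Fin r) ℝ[X] := fromBlocks (T.map Polynomial.C) 0 0 1
  have h1 : fromBlocks (charmatrix (N * A * T)) (-((N * B * σ.permMatrix ℝ).map Polynomial.C))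
      ((C * T).map Polynomial.C) 0 =
      N' * systemMatrix A B C * T' * fromBlocks 1 0 0 ((σ.permMatrix ℝ).map Polynomial.C) := by
    have h2 : charmatrix (N * A * T) =
        N.map Polynomial.C * charmatrix A * T.map Polynomial.C := by
      simp only [charmatrix, RingHom.mapMatrix_apply, Matrix.map_mul, Matrix.mul_sub,
        Matrix.sub_mul, scalar_apply, ← smul_one_eq_diagonal, Matrix.mul_smul, Matrix.smul_mul,
        Matrix.mul_one, hNT']
    rw [h2, systemMatrix, fromBlocks_multiply, fromBlocks_multiply, fromBlocks_multiply]
    simp only [Matrix.map_mul, Matrix.mul_zero, Matrix.zero_mul, neg_zero,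
      Matrix.one_mul, Matrix.mul_one, add_zero, zero_add, Matrix.mul_neg, Matrix.neg_mul]
  have h3 : IsUnit ((fromBlocks (1 : Matrix S S ℝ[X]) 0 0
      ((σ.permMatrix ℝ).map Polynomial.C)).det) := by
    have h4 : ((σ.permMatrix ℝ).map Polynomial.C).det = Polynomial.C (σ.permMatrix ℝ).det := by
      rw [RingHom.map_det]
      rfl
    rw [det_fromBlocks_zero₂₁, det_one, one_mul, h4, det_permutation]
    exact ((Equiv.Perm.sign σ).isUnit.map (Int.castRingHom ℝ)).map Polynomial.C
  rw [h1, det_mul, det_conj_of_mul_eq_one]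
  · exact associated_mul_unit_right _ _ h3
  · rw [fromBlocks_multiply]
    simp [hNT']
  · rw [fromBlocks_multiply]
    simp [hTN']

/-- The determinant of the pencil is `s ^ (r - l_{ν-1}) det P(s)`, up to a constant. -/
theorem associated_det_zeroPencil (hB : B.rank = r) (hAB : Controllable A B)
    {N : Matrix (StateIdx A B) (Fin n) ℝ} {T : Matrix (Fin n) (StateIdx A B) ℝ}
    {σ : Equiv.Perm (Fin r)} (h : IsYokoyama A B N T σ) :
    Associated (zeroPencil A B C T).det
      (X ^ (r - blockSize A B (ctrlIndex A B - 1)) * (systemMatrix A B C).det) := by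
  rcases Nat.eq_zero_or_pos (ctrlIndex A B) with hν | hν
  · -- without blocks there is neither state nor input
    have hn : n = 0 := by
      rw [← ctrlRank_ctrlIndex A B hAB, hν, ctrlRank_zero]
    have hr : r = 0 := by
      rw [← blockSize_ctrlIndex A B hB hAB, hν]
      rfl
    have h1 : IsEmpty (HeadIdx A B ⊕ Fin r) := by
      rw [isEmpty_sum]
      exact ⟨⟨fun p => absurd p.1.2 (by omega)⟩, by rw [hr]; infer_instance⟩
    have h2 : IsEmpty (Fin n ⊕ Fin r) := by
      rw [hn, hr]
      infer_instance
    rw [det_isEmpty, det_isEmpty, show r - blockSize A B (ctrlIndex A B - 1) = 0 by omega]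
    simp
  · have hle := blockSize_le A B hAB (Nat.sub_le (ctrlIndex A B) 1)
    have h1 : Associated (X ^ blockSize A B (ctrlIndex A B - 1) * (zeroPencil A B C T).det)
        (X ^ r * _) :=
      associated_det_pencil hν (blockSize_ctrlIndex A B hB hAB)
        (fun i j hij hj => blockSize_mono A B hAB hij hj) (N * A * T) (N * B * σ.permMatrix ℝ)
        (C * T) h.companion h.input_top h.input_upper h.input_diag
    have h2 := h1.trans ((associated_det_systemMatrix h.mul_inv h.inv_mul σ).symm.mul_left _)
    have h3 : (X : ℝ[X]) ^ r = X ^ blockSize A B (ctrlIndex A B - 1) *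
        X ^ (r - blockSize A B (ctrlIndex A B - 1)) := by
      rw [← pow_add, Nat.add_sub_cancel' hle]
    rw [h3, mul_assoc] at h2
    exact h2.of_mul_left (Associated.refl _) (pow_ne_zero _ X_ne_zero)

end ZeroPolynomial

end SystemZeros

open SystemZeros
theorem theorem7p7 {n r : ℕ} (A : Matrix (Fin n) (Fin n) ℝ) (B : Matrix (Fin n) (Fin r) ℝ)
    (C : Matrix (Fin r) (Fin n) ℝ) (hB : B.rank = r) (hAB : Controllable A B) :
    (∃ (N : Matrix (StateIdx A B) (Fin n) ℝ) (T : Matrix (Fin n) (StateIdx A B) ℝ)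
      (σ : Equiv.Perm (Fin r)), IsYokoyama A B N T σ) ∧
    blockSize A B (ctrlIndex A B - 1) ≤ r ∧
    Fintype.card (HeadIdx A B ⊕ Fin r) = n - blockSize A B (ctrlIndex A B - 1) ∧
    ∀ (N : Matrix (StateIdx A B) (Fin n) ℝ) (T : Matrix (Fin n) (StateIdx A B) ℝ)
      (σ : Equiv.Perm (Fin r)), IsYokoyama A B N T σ →
      (IsRegularPencil (zeroPencil A B C T) ↔ (systemMatrix A B C).det ≠ 0) ∧
      ((systemMatrix A B C).det ≠ 0 →
        genEigenvalues (zeroPencil A B C T) =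
          systemZeros A B C +
            Multiset.replicate (r - blockSize A B (ctrlIndex A B - 1)) (0 : ℂ)) ∧
      ((systemMatrix A B C).det ≠ 0 → blockSize A B (ctrlIndex A B - 1) = r →
        Fintype.card (HeadIdx A B ⊕ Fin r) = n - r ∧
        genEigenvalues (zeroPencil A B C T) = systemZeros A B C) := by
  have hcard : Fintype.card (HeadIdx A B ⊕ Fin r) = n - blockSize A B (ctrlIndex A B - 1) := by
    have h1 := sum_blockSize A B hAB
    have h2 := blockSize_ctrlIndex A B hB hAB
    rw [Fintype.card_sum, Fintype.card_sigma]
    simp only [Fintype.card_fin]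
    rw [Fin.sum_univ_eq_sum_range (fun i => blockSize A B i)]
    rcases Nat.eq_zero_or_pos (ctrlIndex A B) with hν | hν
    · rw [hν] at h1 h2 ⊢
      simp [blockSize] at h1 h2 ⊢
      omega
    · obtain ⟨m, hm⟩ : ∃ m, ctrlIndex A B = m + 1 := ⟨ctrlIndex A B - 1, by omega⟩
      rw [hm] at h1 h2 ⊢
      rw [Finset.sum_range_succ, Finset.sum_range_succ, h2] at h1
      simp only [Nat.add_sub_cancel]
      omega
  have heig : ∀ (N : Matrix (StateIdx A B) (Fin n) ℝ) (T : Matrix (Fin n) (StateIdx A B) ℝ)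
      (σ : Equiv.Perm (Fin r)), IsYokoyama A B N T σ → (systemMatrix A B C).det ≠ 0 →
        genEigenvalues (zeroPencil A B C T) = systemZeros A B C +
          Multiset.replicate (r - blockSize A B (ctrlIndex A B - 1)) (0 : ℂ) := by
    intro N T σ h hdet
    rw [genEigenvalues, aroots_eq_of_associated (associated_det_zeroPencil hB hAB h),
      Polynomial.aroots_mul (mul_ne_zero (pow_ne_zero _ Polynomial.X_ne_zero) hdet),
      Polynomial.aroots_X_pow, systemZeros_eq A B C hdet, add_comm, Multiset.nsmul_singleton]
  refine ⟨exists_isYokoyama A B hB hAB, blockSize_le A B hAB (Nat.sub_le _ _), hcard,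
    fun N T σ h => ⟨?_, heig N T σ h, fun hdet hr => ⟨by rw [hcard, hr], ?_⟩⟩⟩
  · rw [IsRegularPencil, (associated_det_zeroPencil hB hAB h).ne_zero_iff,
      mul_ne_zero_iff_left (pow_ne_zero _ Polynomial.X_ne_zero)]
  · rw [heig N T σ h hdet, hr, Nat.sub_self, Multiset.replicate_zero, add_zero]
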